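/- For an irrational $\alpha\in(0,1)$ with regular continued fraction expansion $\alpha=[a_1,a_2,\ldots]$ let $q_n=q_n(\alpha)$ be the denominators of its convergents, that is $q_{-1}=0$, $q_0=1$ and $q_{n+1}=a_{n+1}q_n+q_{n-1}$ for $n\ge 0$. For $n\geq 1$ put $$W_n(\alpha)=\begin{cases}\dfrac{\log q_{n+1}-\log q_n}{\log q_n}&\text{if } q_{n+1}<2q_n\log q_n,\\[2ex] \dfrac{\max\left\{1,\ \log\log q_n-\log\log\frac{q_{n+1}}{q_n\log q_n}\right\}}{\log q_n}&\text{if } q_{n+1}\geq 2q_n\log q_n,\end{cases}$$ where, in the case $q_n=1$ (possible only for $n=1$, $a_1=1$), in which the formula is undefined, we set $W_n(\alpha)=0$. All $W_n(\alpha)$ are nonnegative. Then the set $$E=\Big\{\alpha\in(0,1)\setminus\mathbb{Q}:\ \sum_{n=1}^{\infty}W_n(\alpha)<\infty\Big\}$$ has Lebesgue measure zero, and its Hausdorff dimension is $\dim_{\mathrm H}(E)=\frac12$. -/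

import Mathlib

/-- The denominator `q_n` of the `n`-th convergent of the regular continued fraction
expansion of `α`, with `q_0 = 1` and, for `α ∈ (0,1)`, `q_1 = a_1`. -/
noncomputable def cfDen (α : ℝ) (n : ℕ) : ℝ := (GenContFract.of α).dens n

/-- The weights `W_n(α)`. For irrational `α ∈ (0,1)` and `n ≥ 1` the formula is meaningful and
nonnegative except when `q_n = 1`, which happens only for `n = 1`, `a_1 = 1`; the division by
`log 1 = 0` makes that single term equal to `0`, i.e. it is omitted. -/
noncomputable def W (α : ℝ) (n : ℕ) : ℝ :=
  if cfDen α (n + 1) < 2 * cfDen α n * Real.log (cfDen α n) then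
    (Real.log (cfDen α (n + 1)) - Real.log (cfDen α n)) / Real.log (cfDen α n)
  else
    max 1 (Real.log (Real.log (cfDen α n)) -
        Real.log (Real.log (cfDen α (n + 1) / (cfDen α n * Real.log (cfDen α n))))) /
      Real.log (cfDen α n)

/-- The irrational `α ∈ (0,1)` with `∑_{n ≥ 1} W_n(α) < ∞`. -/
def finiteWSet : Set ℝ :=
  {α | α ∈ Set.Ioo (0 : ℝ) 1 ∧ Irrational α ∧ Summable fun n : ℕ => W α (n + 1)}

/-!
If `∑ W_n` converges, then Kronecker's lemma shows that the steps of the continued fraction with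
`q_{n+1} < 2 q_n log q_n`, hence those with partial quotient at most a fixed `M`, contribute only
`o(log q_n)` to `log q_n`. Since a cylinder with denominator `q` has diameter at most `q⁻²`,
dividing its weight by a large power of the growth `q_{k+1} / q_k` at each step with a small partial
quotient costs only a factor `q ^ (-ε)` in the cover of the set by cylinders. With this penalty, the
sums of `q ^ (-p)` over the words of length `n` decay geometrically for every `p > 1`, and so
`μH[s]` of the set vanishes for every `s > 1/2`.

Conversely, partial quotients `a_k` of size about `2 ^ k` make `log q_n` at least of order `n ^ 2`,
and the sum converges. If they are prescribed by the mixed radix digits of `y ∈ [0, 1)` in the bases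
`2, 4, 8, …`, then `y` is an `s`-Hölder function of the resulting number for every `s < 1/2`.
-/

open Filter Topology MeasureTheory
open scoped ENNReal NNReal

/-! ### Hausdorff dimension -/

section HausdorffDimension

variable {X Y : Type*} [EMetricSpace X]

theorem hausdorffMeasure_eq_zero_of_tendsto_tsum_ediam_rpow [MeasurableSpace X] [BorelSpace X]
    {ι : ℕ → Type*} [∀ n, Countable (ι n)] {d : ℝ} (hd : 0 < d) {E : Set X} {t : ∀ n, ι n → Set X}
    (hcover : ∀ x ∈ E, ∀ᶠ n in atTop, ∃ i, x ∈ t n i)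
    (hsum : Tendsto (fun n => ∑' i, Metric.ediam (t n i) ^ d) atTop (𝓝 0)) :
    μH[d] E = 0 := by
  have htail (N : ℕ) : μH[d] {x | ∀ n ≥ N, ∃ i, x ∈ t n i} = 0 := by
    refine le_antisymm ((Measure.hausdorffMeasure_le_liminf_tsum d _
      (fun n => (∑' i, Metric.ediam (t n i) ^ d) ^ d⁻¹) ?_ t ?_ ?_).trans hsum.liminf_eq.le) zero_le
    · simpa [hd] using hsum.ennrpow_const d⁻¹
    · exact .of_forall fun n i => (ENNReal.le_rpow_inv_iff hd).mpr (ENNReal.le_tsum i)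
    · filter_upwards [eventually_ge_atTop N] with n hn x hx
      exact Set.mem_iUnion.mpr (hx n hn)
  exact measure_mono_null
    (fun x hx => Set.mem_iUnion.mpr (eventually_atTop.mp (hcover x hx)))
    (measure_iUnion_null htail)

theorem dimH_le_dimH_image_div_of_edist_le [EMetricSpace Y] {C r : ℝ≥0} (hr : 0 < r) {f : X → Y}
    {s : Set X} (hf : ∀ x ∈ s, ∀ y ∈ s, edist x y ≤ C * edist (f x) (f y) ^ (r : ℝ)) :
    dimH s ≤ dimH (f '' s) / r := by
  rcases s.eq_empty_or_nonempty with rfl | ⟨x₀, -⟩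
  · simp
  have : Nonempty X := ⟨x₀⟩
  have hinj : s.InjOn f := fun x hx y hy hxy => by
    simpa [hxy, hr] using hf x hx y hy
  have hinv : HolderOnWith C r (Function.invFunOn f s) (f '' s) := by
    rintro _ ⟨x, hx, rfl⟩ _ ⟨y, hy, rfl⟩
    rw [hinj.leftInvOn_invFunOn hx, hinj.leftInvOn_invFunOn hy]
    exact hf x hx y hy
  simpa only [hinj.invFunOn_image subset_rfl] using hinv.dimH_image_le hr

end HausdorffDimension

/-! ### Summation and logarithms -/

/-- A one-sided form of Kronecker's lemma. -/
theorem eventually_le_mul_of_le_add_mul {s L w : ℕ → ℝ} (hL : Tendsto L atTop atTop)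
    (hmono : Monotone L) (hw : ∀ n, 0 ≤ w n) (hsum : Summable w)
    (hstep : ∀ᶠ n in atTop, s (n + 1) ≤ s n + w n * L n) {ε : ℝ} (hε : 0 < ε) :
    ∀ᶠ n in atTop, s n ≤ ε * L n := by
  obtain ⟨K, hK⟩ := eventually_atTop.mp (hstep.and (hL.eventually_ge_atTop 0))
  obtain ⟨N, hKN, hN⟩ := ((eventually_ge_atTop K).and
    ((tendsto_sum_nat_add w).eventually_le_const (half_pos hε))).exists
  have hpartial (m : ℕ) : ∑ k ∈ Finset.range m, w (k + N) ≤ ε / 2 :=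
    (((summable_nat_add_iff N).mpr hsum).sum_le_tsum _ fun k _ => hw _).trans hN
  have hiterate (m : ℕ) :
      s (m + N) ≤ s N + L (m + N) * ∑ k ∈ Finset.range m, w (k + N) := by
    induction m with
    | zero => simp
    | succ m ih =>
      rw [Nat.add_right_comm, Finset.sum_range_succ]
      have hL_succ : L (m + N) ≤ L (m + N + 1) := hmono (Nat.le_succ _)
      have hsum_nonneg : 0 ≤ ∑ k ∈ Finset.range m, w (k + N) + w (m + N) :=
        add_nonneg (Finset.sum_nonneg fun k _ => hw _) (hw _)
      linarith [(hK (m + N) (by lia)).1, mul_le_mul_of_nonneg_right hL_succ hsum_nonneg]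
  filter_upwards [eventually_ge_atTop N, hL.eventually_ge_atTop (s N / (ε / 2))] with n hn hsN
  obtain ⟨m, rfl⟩ := Nat.exists_eq_add_of_le' hn
  have hinitial : s N ≤ L (m + N) * (ε / 2) := (div_le_iff₀ (half_pos hε)).mp hsN
  have hrest := mul_le_mul_of_nonneg_left (hpartial m) (hK (m + N) (by lia)).2
  linarith [hiterate m]

theorem one_add_log_le_rpow_div {x ε : ℝ} (hx : 0 < x) (hε : 0 < ε) (hε1 : ε ≤ 1) :
    1 + Real.log x ≤ x ^ ε / ε := by
  have hlog := Real.log_le_sub_one_of_pos (Real.rpow_pos_of_pos hx ε)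
  rw [Real.log_rpow hx] at hlog
  rw [le_div_iff₀ hε]
  linarith

theorem prod_range_pow_add {b : ℝ} (hb : 0 < b) (c n : ℕ) :
    ∏ k ∈ Finset.range n, b ^ (k + c) = b ^ ((n : ℝ) * (n - 1) / 2 + c * n) := by
  induction n with
  | zero => simp
  | succ n ih =>
    rw [Finset.prod_range_succ, ih, ← Real.rpow_natCast, ← Real.rpow_add hb]
    push_cast
    ring_nf

/-! ### Mixed radix digits -/

/-- The `n`-th digit after the point in the expansion of `y ∈ [0, 1)` with respect to the variable
bases `b 0, b 1, … ≥ 2`, so that `y = ∑ n, mixedRadixDigit b y n / (b 0 * ⋯ * b n)`. -/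
noncomputable def mixedRadixDigit (b : ℕ → ℕ) (y : ℝ) (n : ℕ) : ℕ :=
  ⌊y * ∏ k ∈ Finset.range (n + 1), (b k : ℝ)⌋₊ % b n

section MixedRadix

variable {b : ℕ → ℕ} {y z : ℝ}

theorem mixedRadixDigit_lt (hb : ∀ k, b k ≠ 0) (y : ℝ) (n : ℕ) : mixedRadixDigit b y n < b n :=
  Nat.mod_lt _ (Nat.pos_of_ne_zero (hb n))

theorem floor_mul_prod_succ (hb : ∀ k, b k ≠ 0) (y : ℝ) (n : ℕ) :
    ⌊y * ∏ k ∈ Finset.range (n + 1), (b k : ℝ)⌋₊ =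
      b n * ⌊y * ∏ k ∈ Finset.range n, (b k : ℝ)⌋₊ + mixedRadixDigit b y n := by
  have hbn : (b n : ℝ) ≠ 0 := Nat.cast_ne_zero.mpr (hb n)
  have hquot : ⌊y * ∏ k ∈ Finset.range (n + 1), (b k : ℝ)⌋₊ / b n =
      ⌊y * ∏ k ∈ Finset.range n, (b k : ℝ)⌋₊ := by
    rw [← Nat.floor_div_natCast, Finset.prod_range_succ, ← mul_assoc, mul_div_cancel_right₀ _ hbn]
  rw [← hquot, mixedRadixDigit, Nat.div_add_mod]

theorem abs_sub_le_of_mixedRadixDigit_eq (hb : ∀ k, b k ≠ 0) (hy : y ∈ Set.Ico (0 : ℝ) 1)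
    (hz : z ∈ Set.Ico (0 : ℝ) 1) {n : ℕ}
    (h : ∀ k < n, mixedRadixDigit b y k = mixedRadixDigit b z k) :
    |y - z| ≤ (∏ k ∈ Finset.range n, (b k : ℝ))⁻¹ := by
  have hfloor : ⌊y * ∏ k ∈ Finset.range n, (b k : ℝ)⌋₊ =
      ⌊z * ∏ k ∈ Finset.range n, (b k : ℝ)⌋₊ := by
    induction n with
    | zero => simp [Nat.floor_eq_zero.mpr hy.2, Nat.floor_eq_zero.mpr hz.2]
    | succ n ih =>
      rw [floor_mul_prod_succ hb, floor_mul_prod_succ hb, ih fun k hk => h k (by lia),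
        h n n.lt_succ_self]
  have hprod : 0 < ∏ k ∈ Finset.range n, (b k : ℝ) :=
    Finset.prod_pos fun k _ => Nat.cast_pos.mpr (Nat.pos_of_ne_zero (hb k))
  have hdist :
      |y * (∏ k ∈ Finset.range n, (b k : ℝ)) - z * ∏ k ∈ Finset.range n, (b k : ℝ)| < 1 := by
    refine Int.abs_sub_lt_one_of_floor_eq_floor ?_
    rw [← Int.natCast_floor_eq_floor (mul_nonneg hy.1 hprod.le),
      ← Int.natCast_floor_eq_floor (mul_nonneg hz.1 hprod.le), hfloor]
  rw [← sub_mul, abs_mul, abs_of_pos hprod] at hdist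
  rw [← one_div, le_div_iff₀ hprod]
  exact hdist.le

theorem injOn_mixedRadixDigit (hb : ∀ k, 2 ≤ b k) :
    Set.InjOn (mixedRadixDigit b) (Set.Ico 0 1) := by
  intro y hy z hz h
  by_contra hyz
  obtain ⟨n, hn⟩ := exists_pow_lt_of_lt_one (abs_pos.mpr (sub_ne_zero.mpr hyz))
    (by norm_num : (2 : ℝ)⁻¹ < 1)
  have hle := abs_sub_le_of_mixedRadixDigit_eq (fun k => (zero_lt_two.trans_le (hb k)).ne') hy hz
    (n := n) fun k _ => congrFun h k
  have hprod : (2 : ℝ) ^ n ≤ ∏ k ∈ Finset.range n, (b k : ℝ) := by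
    simpa using Finset.prod_le_prod (s := Finset.range n) (fun _ _ => zero_le_two)
      fun k _ => (by exact_mod_cast hb k : (2 : ℝ) ≤ b k)
  rw [inv_pow] at hn
  exact absurd (hle.trans (inv_anti₀ (by positivity) hprod)) hn.not_ge

end MixedRadix

/-! ### Denominators of words -/

/-- The quotient `q_{n-1} / q_n` of the last two denominators, for the word of the first `n`
partial quotients. Words are reversed, the last partial quotient coming first, and each letter `a`
stands for the partial quotient `a + 1`, so that every list of natural numbers is a word. -/
noncomputable def denRatio : List ℕ → ℝ
  | [] => 0
  | a :: l => ((a : ℝ) + 1 + denRatio l)⁻¹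

/-- The growth `q_{n+1} / q_n` of the denominator when the letter `a` is added to a word. -/
noncomputable def growth (a : ℕ) (l : List ℕ) : ℝ := (a : ℝ) + 1 + denRatio l

/-- The denominator `q_n` attached to a word, encoded as in `denRatio`. -/
noncomputable def wordDen : List ℕ → ℝ
  | [] => 1
  | a :: l => wordDen l * growth a l

/-- The word formed by the first `n` terms of a sequence, the last one coming first. -/
def initialWord (a : ℕ → ℕ) (n : ℕ) : List ℕ := List.ofFn fun i : Fin n => a i.rev

@[simp]
theorem initialWord_zero (a : ℕ → ℕ) : initialWord a 0 = [] := rfl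

theorem initialWord_succ (a : ℕ → ℕ) (n : ℕ) : initialWord a (n + 1) = a n :: initialWord a n := by
  simp [initialWord, List.ofFn_succ]

@[simp]
theorem length_initialWord (a : ℕ → ℕ) (n : ℕ) : (initialWord a n).length = n :=
  List.length_ofFn

theorem initialWord_eq_iff {a b : ℕ → ℕ} {n : ℕ} :
    initialWord a n = initialWord b n ↔ ∀ k < n, a k = b k := by
  simp only [initialWord, List.ofFn_inj, funext_iff]
  rw [Fin.rev_surjective.forall]
  simp [Fin.forall_iff]

theorem denRatio_nonneg (l : List ℕ) : 0 ≤ denRatio l := by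
  induction l with
  | nil => exact le_rfl
  | cons a l ih => rw [denRatio]; positivity

theorem one_le_growth (a : ℕ) (l : List ℕ) : 1 ≤ growth a l := by
  rw [growth]
  linarith [denRatio_nonneg l, a.cast_nonneg (α := ℝ)]

theorem denRatio_le_one (l : List ℕ) : denRatio l ≤ 1 := by
  cases l with
  | nil => exact zero_le_one
  | cons a l => exact inv_le_one_of_one_le₀ (one_le_growth a l)

theorem one_le_wordDen (l : List ℕ) : 1 ≤ wordDen l := by
  induction l with
  | nil => exact le_rfl
  | cons a l ih => exact one_le_mul_of_one_le_of_one_le ih (one_le_growth a l)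

theorem wordDen_pos (l : List ℕ) : 0 < wordDen l := zero_lt_one.trans_le (one_le_wordDen l)

theorem wordDen_le_cons (a : ℕ) (l : List ℕ) : wordDen l ≤ wordDen (a :: l) :=
  le_mul_of_one_le_right (wordDen_pos l).le (one_le_growth a l)

theorem wordDen_mul_denRatio (a : ℕ) (l : List ℕ) :
    wordDen (a :: l) * denRatio (a :: l) = wordDen l :=
  mul_inv_cancel_right₀ (zero_lt_one.trans_le (one_le_growth a l)).ne' _

theorem wordDen_cons_cons (a b : ℕ) (l : List ℕ) :
    wordDen (a :: b :: l) = (a + 1) * wordDen (b :: l) + wordDen l := by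
  rw [← wordDen_mul_denRatio b l, wordDen, growth]
  ring

theorem length_le_wordDen (l : List ℕ) : (l.length : ℝ) ≤ wordDen l := by
  induction l with
  | nil => simp [wordDen]
  | cons a l ih =>
    cases l with
    | nil => simpa using one_le_wordDen [a]
    | cons b l =>
      have hgain : 0 ≤ (a : ℝ) * wordDen (b :: l) := mul_nonneg a.cast_nonneg (wordDen_pos _).le
      rw [wordDen_cons_cons, List.length_cons]
      push_cast at ih ⊢
      linarith [one_le_wordDen l]

theorem wordDen_initialWord_mono (a : ℕ → ℕ) : Monotone fun n => wordDen (initialWord a n) :=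
  monotone_nat_of_le_succ fun n => by
    rw [initialWord_succ]
    exact wordDen_le_cons _ _

theorem tendsto_wordDen_initialWord (a : ℕ → ℕ) :
    Tendsto (fun n => wordDen (initialWord a n)) atTop atTop :=
  tendsto_atTop_mono (fun n => by simpa using length_le_wordDen (initialWord a n))
    tendsto_natCast_atTop_atTop

theorem prod_le_wordDen (a : ℕ → ℕ) (n : ℕ) :
    ∏ k ∈ Finset.range n, ((a k : ℝ) + 1) ≤ wordDen (initialWord a n) := by
  induction n with
  | zero => exact le_rfl
  | succ n ih =>
    rw [Finset.prod_range_succ, initialWord_succ, wordDen]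
    exact mul_le_mul ih (le_add_of_nonneg_right (denRatio_nonneg _)) (by positivity)
      (wordDen_pos _).le

/-! ### Complete remainders -/

/-- `x` is the sequence of complete remainders of the continued fraction in `(0, 1)` with partial
quotients `a n + 1`, that is, the orbit of `x 0` under the Gauss map. -/
structure IsGaussOrbit (a : ℕ → ℕ) (x : ℕ → ℝ) : Prop where
  pos : ∀ n, 0 < x n
  lt_one : ∀ n, x n < 1
  inv_eq : ∀ n, (x n)⁻¹ = a n + 1 + x (n + 1)

theorem exists_isGaussOrbit_of_irrational {α : ℝ} (hα : α ∈ Set.Ioo (0 : ℝ) 1)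
    (hirr : Irrational α) : ∃ a x, IsGaussOrbit a x ∧ x 0 = α := by
  let x (n : ℕ) : ℝ := (fun y : ℝ => Int.fract y⁻¹)^[n] α
  have hsucc (n : ℕ) : x (n + 1) = Int.fract (x n)⁻¹ := Function.iterate_succ_apply' _ _ _
  have hx_irr (n : ℕ) : Irrational (x n) := by
    induction n with
    | zero => exact hirr
    | succ n ih =>
      rw [hsucc, Int.fract]
      exact (irrational_inv_iff.mpr ih).sub_intCast _
  have hx_mem (n : ℕ) : x n ∈ Set.Ioo (0 : ℝ) 1 := by
    cases n with
    | zero => exact hα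
    | succ n =>
      have hnonneg : 0 ≤ x (n + 1) := hsucc n ▸ Int.fract_nonneg _
      exact ⟨hnonneg.lt_of_ne (hx_irr (n + 1)).ne_zero.symm, hsucc n ▸ Int.fract_lt_one _⟩
  refine ⟨fun n => ⌊(x n)⁻¹⌋₊ - 1, x, ⟨fun n => (hx_mem n).1, fun n => (hx_mem n).2, fun n => ?_⟩,
    rfl⟩
  have hinv : 1 ≤ (x n)⁻¹ := (one_le_inv₀ (hx_mem n).1).mpr (hx_mem n).2.le
  have hfloor : 1 ≤ ⌊(x n)⁻¹⌋₊ := (Nat.one_le_floor_iff _).mpr hinv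
  rw [hsucc, Nat.cast_sub hfloor, Nat.cast_one, sub_add_cancel,
    natCast_floor_eq_intCast_floor (zero_le_one.trans hinv), Int.floor_add_fract]

theorem exists_remainders (n : ℕ) (a : ℕ → ℕ) : ∃ x : ℕ → ℝ, (∀ k, x k ∈ Set.Icc (0 : ℝ) 1) ∧
    ∀ k < n, x k * (a k + 1 + x (k + 1)) = 1 := by
  induction n generalizing a with
  | zero => exact ⟨0, by simp, by simp⟩
  | succ n ih =>
    obtain ⟨x, hx_mem, hx⟩ := ih fun k => a (k + 1)
    have hone : 1 ≤ (a 0 : ℝ) + 1 + x 0 := by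
      linarith [(hx_mem 0).1, (a 0).cast_nonneg (α := ℝ)]
    refine ⟨fun | 0 => ((a 0 : ℝ) + 1 + x 0)⁻¹ | k + 1 => x k, ?_, ?_⟩
    · rintro (_ | k)
      · exact ⟨inv_nonneg.mpr (zero_le_one.trans hone), inv_le_one_of_one_le₀ hone⟩
      · exact hx_mem k
    · rintro (_ | k) hk
      · exact inv_mul_cancel₀ (zero_lt_one.trans_le hone).ne'
      · exact hx k (by lia)

/- The equations for the remainders are closed conditions on the compact space `[0, 1]^ℕ`, and any
finitely many of them are solvable. -/
theorem exists_isGaussOrbit (a : ℕ → ℕ) : ∃ x, IsGaussOrbit a x := by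
  let F (n : ℕ) : Set (ℕ → ℝ) := (Set.univ.pi fun _ => Set.Icc (0 : ℝ) 1) ∩
    ⋂ k < n, {x | x k * (a k + 1 + x (k + 1)) = 1}
  have hclosed (n : ℕ) : IsClosed (⋂ k < n, {x : ℕ → ℝ | x k * (a k + 1 + x (k + 1)) = 1}) :=
    isClosed_biInter fun k _ => isClosed_eq (by fun_prop) continuous_const
  have hcompact (n : ℕ) : IsCompact (F n) :=
    (isCompact_univ_pi fun _ => isCompact_Icc).inter_right (hclosed n)
  obtain ⟨x, hx⟩ : (⋂ n, F n).Nonempty := by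
    refine IsCompact.nonempty_iInter_of_sequence_nonempty_isCompact_isClosed F ?_ ?_ (hcompact 0)
      fun n => (hcompact n).isClosed
    · exact fun n => Set.inter_subset_inter_right _
        (Set.biInter_subset_biInter_left fun k hk => Nat.lt_succ_of_lt hk)
    · intro n
      obtain ⟨x, hx_mem, hx⟩ := exists_remainders n a
      exact ⟨x, fun k _ => hx_mem k, Set.mem_iInter₂.mpr hx⟩
  have hx_mem (k : ℕ) : x k ∈ Set.Icc (0 : ℝ) 1 := (Set.mem_iInter.mp hx 0).1 k trivial
  have hx_eq (k : ℕ) : x k * (a k + 1 + x (k + 1)) = 1 :=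
    Set.mem_iInter₂.mp (Set.mem_iInter.mp hx (k + 1)).2 k k.lt_succ_self
  have hx_pos (k : ℕ) : 0 < x k :=
    (hx_mem k).1.lt_of_ne fun h => by simpa [← h] using hx_eq k
  refine ⟨x, hx_pos, fun k => ?_, fun k => inv_eq_of_mul_eq_one_right (hx_eq k)⟩
  have hlarge : 1 < (a k : ℝ) + 1 + x (k + 1) := by
    linarith [hx_pos (k + 1), (a k).cast_nonneg (α := ℝ)]
  rw [eq_inv_of_mul_eq_one_left (hx_eq k)]
  exact inv_lt_one_of_one_lt₀ hlarge

namespace IsGaussOrbit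

variable {a b : ℕ → ℕ} {x y : ℕ → ℝ}

theorem mul_eq_one (h : IsGaussOrbit a x) (n : ℕ) : x n * (a n + 1 + x (n + 1)) = 1 := by
  rw [← h.inv_eq, mul_inv_cancel₀ (h.pos n).ne']

theorem fract_inv (h : IsGaussOrbit a x) (n : ℕ) : Int.fract (x n)⁻¹ = x (n + 1) := by
  rw [h.inv_eq, Int.fract_eq_iff]
  exact ⟨(h.pos _).le, h.lt_one _, (a n : ℤ) + 1, by push_cast; ring⟩

theorem floor_inv (h : IsGaussOrbit a x) (n : ℕ) : ⌊(x n)⁻¹⌋ = (a n : ℤ) + 1 := by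
  rw [h.inv_eq, Int.floor_eq_iff]
  push_cast
  constructor <;> linarith [h.pos (n + 1), h.lt_one (n + 1)]

theorem exists_stream_eq (h : IsGaussOrbit a x) (n : ℕ) :
    ∃ p, GenContFract.IntFractPair.stream (x 0) n = some p ∧ p.fr = x n := by
  induction n with
  | zero => exact ⟨_, rfl, Int.fract_eq_self.mpr ⟨(h.pos 0).le, h.lt_one 0⟩⟩
  | succ n ih =>
    obtain ⟨p, hp, hfr⟩ := ih
    refine ⟨_, GenContFract.IntFractPair.stream_succ_of_some hp (hfr ▸ (h.pos n).ne'), ?_⟩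
    rw [hfr]
    exact h.fract_inv n

theorem irrational (h : IsGaussOrbit a x) : Irrational (x 0) := by
  rintro ⟨q, hq⟩
  obtain ⟨n, hn⟩ := (GenContFract.terminates_iff_rat (x 0)).mpr ⟨q, hq.symm⟩
  obtain ⟨p, hp, -⟩ := h.exists_stream_eq (n + 1)
  simp [GenContFract.of_terminatedAt_n_iff_succ_nth_intFractPair_stream_eq_none.mp hn] at hp

theorem get?_of (h : IsGaussOrbit a x) (n : ℕ) :
    (GenContFract.of (x 0)).s.get? n = some ⟨1, a n + 1⟩ := by
  obtain ⟨p, hp, hfr⟩ := h.exists_stream_eq n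
  rw [GenContFract.get?_of_eq_some_of_get?_intFractPair_stream_fr_ne_zero hp
    (hfr ▸ (h.pos n).ne'), hfr]
  simp [GenContFract.IntFractPair.of, h.floor_inv]

theorem cfDen_eq (h : IsGaussOrbit a x) (n : ℕ) : cfDen (x 0) n = wordDen (initialWord a n) := by
  induction n using Nat.twoStepInduction with
  | zero => simp [cfDen, wordDen]
  | one =>
    simp [cfDen, initialWord_succ, wordDen, growth, denRatio,
      GenContFract.first_den_eq (h.get?_of 0)]
  | more n ih₁ ih₂ =>
    rw [cfDen, GenContFract.dens_recurrence (h.get?_of (n + 1)) ih₁ ih₂, initialWord_succ a (n + 1),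
      initialWord_succ a n, wordDen_cons_cons]
    ring

theorem prod_pos (h : IsGaussOrbit a x) (n : ℕ) : 0 < ∏ k ∈ Finset.range n, x k :=
  Finset.prod_pos fun k _ => h.pos k

theorem prod_mul_wordDen (h : IsGaussOrbit a x) (n : ℕ) :
    (∏ k ∈ Finset.range n, x k) *
      (wordDen (initialWord a n) * (1 + x n * denRatio (initialWord a n))) = 1 := by
  induction n with
  | zero => simp [wordDen, denRatio]
  | succ n ih =>
    rw [Finset.prod_range_succ, initialWord_succ, mul_add, mul_one, mul_left_comm (wordDen _),
      wordDen_mul_denRatio, wordDen, growth]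
    linear_combination
      ih + (∏ k ∈ Finset.range n, x k) * wordDen (initialWord a n) * h.mul_eq_one n

theorem prod_le_inv_wordDen (h : IsGaussOrbit a x) (n : ℕ) :
    ∏ k ∈ Finset.range n, x k ≤ (wordDen (initialWord a n))⁻¹ := by
  have hden := wordDen_pos (initialWord a n)
  rw [← one_div, le_div_iff₀ hden, ← h.prod_mul_wordDen n]
  refine mul_le_mul_of_nonneg_left (le_mul_of_one_le_right hden.le ?_) (h.prod_pos n).le
  exact le_add_of_nonneg_right (mul_nonneg (h.pos n).le (denRatio_nonneg _))

theorem inv_prod_le_prod (h : IsGaussOrbit a x) {B : ℕ → ℕ} (hB : ∀ k, a k + 2 ≤ B k) (n : ℕ) :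
    (∏ k ∈ Finset.range n, (B k : ℝ))⁻¹ ≤ ∏ k ∈ Finset.range n, x k := by
  rw [← Finset.prod_inv_distrib]
  refine Finset.prod_le_prod (fun k _ => by positivity) fun k _ => ?_
  have hBk : (a k : ℝ) + 2 ≤ B k := by exact_mod_cast hB k
  refine inv_le_of_inv_le₀ (h.pos k) ?_
  rw [h.inv_eq]
  linarith [h.lt_one (k + 1)]

theorem sub_eq (hx : IsGaussOrbit a x) (hy : IsGaussOrbit b y) (n : ℕ) :
    x n - y n = x n * y n * ((b n : ℝ) - a n - (x (n + 1) - y (n + 1))) := by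
  linear_combination y n * hx.mul_eq_one n - x n * hy.mul_eq_one n

theorem abs_sub_eq (hx : IsGaussOrbit a x) (hy : IsGaussOrbit b y) {n : ℕ}
    (hab : ∀ k < n, a k = b k) :
    |x 0 - y 0| =
      (∏ k ∈ Finset.range n, x k) * (∏ k ∈ Finset.range n, y k) * |x n - y n| := by
  induction n with
  | zero => simp
  | succ n ih =>
    rw [ih fun k hk => hab k (by lia), hx.sub_eq hy, hab n n.lt_succ_self, sub_self, zero_sub,
      abs_mul, abs_neg, abs_of_pos (mul_pos (hx.pos n) (hy.pos n)), Finset.prod_range_succ,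
      Finset.prod_range_succ]
    ring

theorem le_abs_sub_of_ne (hx : IsGaussOrbit a x) (hy : IsGaussOrbit b y) {n : ℕ}
    (hab : ∀ k < n, a k = b k) (hne : a n ≠ b n) (hx_half : x (n + 1) ≤ 1 / 2)
    (hy_half : y (n + 1) ≤ 1 / 2) :
    (∏ k ∈ Finset.range (n + 1), x k) * (∏ k ∈ Finset.range (n + 1), y k) / 2 ≤
      |x 0 - y 0| := by
  have hdigits : 1 ≤ |(b n : ℝ) - a n| := by
    exact_mod_cast Int.one_le_abs (sub_ne_zero.mpr (Nat.cast_injective.ne hne.symm))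
  have hrest : |x (n + 1) - y (n + 1)| ≤ 1 / 2 := by
    rw [abs_le]
    constructor <;> linarith [hx.pos (n + 1), hy.pos (n + 1)]
  have hgap : 1 / 2 ≤ |(b n : ℝ) - a n - (x (n + 1) - y (n + 1))| := by
    linarith [abs_sub_abs_le_abs_sub ((b n : ℝ) - a n) (x (n + 1) - y (n + 1))]
  have hprod := mul_pos (hx.prod_pos (n + 1)) (hy.prod_pos (n + 1))
  calc _ ≤ (∏ k ∈ Finset.range (n + 1), x k) * (∏ k ∈ Finset.range (n + 1), y k) *
        |(b n : ℝ) - a n - (x (n + 1) - y (n + 1))| := by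
        rw [div_eq_mul_one_div]
        exact mul_le_mul_of_nonneg_left hgap hprod.le
    _ = |x 0 - y 0| := by
        rw [hx.abs_sub_eq hy hab, hx.sub_eq hy n, abs_mul,
          abs_of_pos (mul_pos (hx.pos n) (hy.pos n)), Finset.prod_range_succ,
          Finset.prod_range_succ]
        ring

end IsGaussOrbit

/-! ### The weights -/

theorem cfDen_le_succ (α : ℝ) (n : ℕ) : cfDen α n ≤ cfDen α (n + 1) := GenContFract.of_den_mono

theorem one_le_cfDen (α : ℝ) (n : ℕ) : 1 ≤ cfDen α n :=
  GenContFract.zeroth_den_eq_one.symm.le.trans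
    (monotone_nat_of_le_succ (cfDen_le_succ α) n.zero_le)

theorem W_nonneg (α : ℝ) (n : ℕ) : 0 ≤ W α n := by
  have hden := one_le_cfDen α n
  have hlog := Real.log_nonneg hden
  have hlog_le := Real.log_le_log (zero_lt_one.trans_le hden) (cfDen_le_succ α n)
  rw [W]
  split_ifs
  · exact div_nonneg (sub_nonneg.mpr hlog_le) hlog
  · exact div_nonneg (zero_le_one.trans (le_max_left _ _)) hlog

theorem W_mul_log_cfDen {α : ℝ} {n : ℕ}
    (h : cfDen α (n + 1) < 2 * cfDen α n * Real.log (cfDen α n))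
    (hlog : Real.log (cfDen α n) ≠ 0) :
    W α n * Real.log (cfDen α n) = Real.log (cfDen α (n + 1)) - Real.log (cfDen α n) := by
  rw [W, if_pos h, div_mul_cancel₀ _ hlog]

theorem W_le {α : ℝ} {n : ℕ} (hlog : 1 ≤ Real.log (cfDen α n)) :
    W α n ≤ (1 + Real.log (Real.log (cfDen α n))) / Real.log (cfDen α n) := by
  have hden := zero_lt_one.trans_le (one_le_cfDen α n)
  have hden_succ := zero_lt_one.trans_le (one_le_cfDen α (n + 1))
  have hlog_pos := zero_lt_one.trans_le hlog
  have hloglog := Real.log_nonneg hlog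
  rw [W]
  split_ifs with hcase
  · gcongr
    have hle := Real.log_le_log hden_succ hcase.le
    rw [Real.log_mul (by positivity) hlog_pos.ne', Real.log_mul two_ne_zero hden.ne'] at hle
    linarith [Real.log_two_lt_d9]
  · gcongr
    refine max_le (by linarith) ?_
    have htwo : 2 ≤ cfDen α (n + 1) / (cfDen α n * Real.log (cfDen α n)) := by
      rw [le_div_iff₀ (by positivity)]
      linarith
    have hlog_two : (2 : ℝ)⁻¹ ≤ Real.log 2 := by linarith [Real.log_two_gt_d9]
    have hinner : -1 ≤ Real.log (Real.log 2) := by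
      have hinv := inv_le_of_inv_le₀ two_pos hlog_two
      linarith [Real.one_sub_inv_le_log_of_pos (Real.log_pos one_lt_two)]
    linarith [Real.log_le_log (Real.log_pos one_lt_two) (Real.log_le_log two_pos htwo)]

theorem W_le_rpow_div {α ε : ℝ} {n : ℕ} (hlog : 1 ≤ Real.log (cfDen α n)) (hε : 0 < ε)
    (hε₁ : ε ≤ 1) : W α n ≤ Real.log (cfDen α n) ^ (ε - 1) / ε := by
  have hlog_pos := zero_lt_one.trans_le hlog
  calc W α n ≤ Real.log (cfDen α n) ^ ε / ε / Real.log (cfDen α n) := by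
        refine (W_le hlog).trans ?_
        gcongr
        exact one_add_log_le_rpow_div hlog_pos hε hε₁
    _ = Real.log (cfDen α n) ^ (ε - 1) / ε := by
        rw [Real.rpow_sub_one hlog_pos.ne']
        ring

theorem summable_W_of_mul_rpow_le_log {α c r : ℝ} (hc : 0 < c) (hr : 1 < r)
    (h : ∀ᶠ n : ℕ in atTop, c * (n : ℝ) ^ r ≤ Real.log (cfDen α n)) : Summable (W α) := by
  let ε := (r - 1) / (2 * r)
  have hr₀ : 0 < r := by linarith
  have hε : 0 < ε := div_pos (by linarith) (by linarith)
  have hε₁ : ε < 1 := by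
    rw [div_lt_one (by linarith)]
    linarith
  have hexp : r * (ε - 1) < -1 := by
    have hrε : r * ε = (r - 1) / 2 := by
      simp only [ε]
      field_simp
    linarith
  have hsum := (Real.summable_nat_rpow.mpr hexp).mul_left (c ^ (ε - 1) / ε)
  refine hsum.of_norm_bounded_eventually_nat ?_
  have hgrowth := ((tendsto_rpow_atTop hr₀).comp tendsto_natCast_atTop_atTop).eventually_ge_atTop
    c⁻¹
  filter_upwards [h, hgrowth] with n hn hn_large
  have hone : 1 ≤ c * (n : ℝ) ^ r := by
    simpa [hc.ne'] using mul_le_mul_of_nonneg_left hn_large hc.le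
  rw [Real.norm_of_nonneg (W_nonneg α n)]
  calc W α n ≤ Real.log (cfDen α n) ^ (ε - 1) / ε := W_le_rpow_div (hone.trans hn) hε hε₁.le
    _ ≤ (c * (n : ℝ) ^ r) ^ (ε - 1) / ε := by
        have := Real.rpow_le_rpow_of_nonpos (zero_lt_one.trans_le hone) hn (sub_nonpos.mpr hε₁.le)
        gcongr
    _ = c ^ (ε - 1) / ε * (n : ℝ) ^ (r * (ε - 1)) := by
        rw [Real.mul_rpow hc.le (by positivity), ← Real.rpow_mul n.cast_nonneg]
        ring

/-! ### The upper bound -/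

section WordWeight

variable {M T : ℕ} {p : ℝ}

/-- The part of the denominator of a word contributed by its small letters, those less than `M`:
the product of the growths of the denominator at the places where such a letter is added. -/
noncomputable def smallPart (M : ℕ) : List ℕ → ℝ
  | [] => 1
  | a :: l => (if a < M then growth a l else 1) * smallPart M l

/-- The weight `q ^ (-p) * S ^ (-T)` of a word with denominator `q` and small part `S`, which
penalizes small letters by a high power `T`. -/
noncomputable def coreWeight (M T : ℕ) (p : ℝ) (l : List ℕ) : ℝ :=
  wordDen l ^ (-p) * (smallPart M l ^ T)⁻¹

/-- A correction of `coreWeight` at the last letter of a word. After a large letter the letter `0`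
lets the denominator grow by a factor close to `1`, so that it is hardly penalized; it occurs at the
expense of the larger value of the correction. -/
noncomputable def boundaryFactor (M : ℕ) (l : List ℕ) : ℝ :=
  if 1 / ((M : ℝ) + 1) ≤ denRatio l then 1 else 4

/-- The weight of a word whose sum over all one-letter extensions is contracting for suitable `M`
and `T`. -/
noncomputable def wordWeight (M T : ℕ) (p : ℝ) (l : List ℕ) : ℝ :=
  boundaryFactor M l * coreWeight M T p l

/-- A bound for the weight of `a :: l` in terms of the core weight of `l`. -/
noncomputable def extensionFactor (M T : ℕ) (p : ℝ) (l : List ℕ) (a : ℕ) : ℝ :=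
  if a < M then (growth a l ^ T)⁻¹ else 4 * ((a : ℝ) + 1) ^ (-p)

/-- Parameters for which the sum of `wordWeight` over the one-letter extensions of a word is at most
half the weight of the word: `M` makes the large letters negligible, and then `T` the small ones. -/
structure IsContracting (M T : ℕ) (p : ℝ) : Prop where
  nonneg : 0 ≤ p
  tsum_tail_le :
    ∑' a : ℕ, ENNReal.ofReal ((((a + M : ℕ) : ℝ) + 1) ^ (-p)) ≤ ENNReal.ofReal (1 / 10)
  mul_inv_pow_le : M * ((1 + 1 / ((M : ℝ) + 1)) ^ T)⁻¹ ≤ 1 / 10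

theorem exists_isContracting (hp : 1 < p) : ∃ M T, IsContracting M T p := by
  have hsum : Summable fun a : ℕ => ((a : ℝ) + 1) ^ (-p) := by
    simpa using (summable_nat_add_iff 1).mpr (Real.summable_nat_rpow.mpr (neg_lt_neg hp))
  obtain ⟨M, hM⟩ := ((tendsto_sum_nat_add fun a : ℕ => ((a : ℝ) + 1) ^ (-p)).eventually_le_const
    (by norm_num : (0 : ℝ) < 1 / 10)).exists
  have hbase : (1 : ℝ) < 1 + 1 / (M + 1) := lt_add_of_pos_right _ (by positivity)
  obtain ⟨T, hT⟩ := pow_unbounded_of_one_lt (10 * (M : ℝ)) hbase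
  refine ⟨M, T, by linarith, ?_, ?_⟩
  · rw [← ENNReal.ofReal_tsum_of_nonneg (fun a => by positivity)
      ((summable_nat_add_iff M).mpr hsum)]
    exact ENNReal.ofReal_le_ofReal hM
  · rw [← div_eq_mul_inv, div_le_iff₀ (by positivity)]
    linarith

theorem one_le_smallPart (M : ℕ) (l : List ℕ) : 1 ≤ smallPart M l := by
  induction l with
  | nil => exact le_rfl
  | cons a l ih =>
    refine one_le_mul_of_one_le_of_one_le ?_ ih
    split_ifs
    · exact one_le_growth a l
    · exact le_rfl

theorem smallPart_pos (M : ℕ) (l : List ℕ) : 0 < smallPart M l :=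
  zero_lt_one.trans_le (one_le_smallPart M l)

theorem coreWeight_nonneg (M T : ℕ) (p : ℝ) (l : List ℕ) : 0 ≤ coreWeight M T p l :=
  mul_nonneg (Real.rpow_nonneg (wordDen_pos l).le _)
    (inv_nonneg.mpr (pow_nonneg (smallPart_pos M l).le _))

theorem one_le_boundaryFactor (M : ℕ) (l : List ℕ) : 1 ≤ boundaryFactor M l := by
  rw [boundaryFactor]
  split_ifs <;> norm_num

theorem boundaryFactor_le_four (M : ℕ) (l : List ℕ) : boundaryFactor M l ≤ 4 := by
  rw [boundaryFactor]
  split_ifs <;> norm_num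

theorem growth_le_of_lt {a : ℕ} (ha : a < M) (l : List ℕ) : growth a l ≤ M + 1 := by
  have ha' : (a : ℝ) + 1 ≤ M := by exact_mod_cast ha
  rw [growth]
  linarith [denRatio_le_one l]

theorem boundaryFactor_cons_of_lt {a : ℕ} (ha : a < M) (l : List ℕ) :
    boundaryFactor M (a :: l) = 1 := by
  refine if_pos ?_
  rw [one_div]
  exact inv_anti₀ (zero_lt_one.trans_le (one_le_growth a l)) (growth_le_of_lt ha l)

theorem coreWeight_cons (M T : ℕ) (p : ℝ) (a : ℕ) (l : List ℕ) :
    coreWeight M T p (a :: l) = coreWeight M T p l *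
      (growth a l ^ (-p) * ((if a < M then growth a l else 1) ^ T)⁻¹) := by
  rw [coreWeight, coreWeight, wordDen, smallPart,
    Real.mul_rpow (wordDen_pos l).le (zero_le_one.trans (one_le_growth a l)), mul_pow, mul_inv]
  ring

theorem wordWeight_cons_le (hp : 0 ≤ p) (a : ℕ) (l : List ℕ) :
    wordWeight M T p (a :: l) ≤ coreWeight M T p l * extensionFactor M T p l a := by
  have hgrowth := zero_lt_one.trans_le (one_le_growth a l)
  rw [wordWeight, coreWeight_cons, mul_left_comm]
  refine mul_le_mul_of_nonneg_left ?_ (coreWeight_nonneg M T p l)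
  rw [extensionFactor]
  split_ifs with ha
  · rw [boundaryFactor_cons_of_lt ha, one_mul]
    exact mul_le_of_le_one_left (by positivity)
      (Real.rpow_le_one_of_one_le_of_nonpos (one_le_growth a l) (neg_nonpos.mpr hp))
  · rw [one_pow, inv_one, mul_one]
    exact mul_le_mul (boundaryFactor_le_four M _)
      (Real.rpow_le_rpow_of_nonpos (by positivity) (le_add_of_nonneg_right (denRatio_nonneg l))
        (neg_nonpos.mpr hp)) (by positivity) (by norm_num)

theorem extensionFactor_nonneg (M T : ℕ) (p : ℝ) (l : List ℕ) (a : ℕ) :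
    0 ≤ extensionFactor M T p l a := by
  have hgrowth := zero_lt_one.trans_le (one_le_growth a l)
  rw [extensionFactor]
  split_ifs <;> positivity

namespace IsContracting

theorem sum_inv_growth_pow_le (h : IsContracting M T p) (l : List ℕ) :
    ∑ a ∈ Finset.range M, (growth a l ^ T)⁻¹ ≤ boundaryFactor M l / 2 - 2 / 5 := by
  let ρ : ℝ := 1 + 1 / ((M : ℝ) + 1)
  have hρ : 0 < ρ := by positivity
  have hinv (a : ℕ) (ha : ρ ≤ growth a l) : (growth a l ^ T)⁻¹ ≤ (ρ ^ T)⁻¹ :=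
    inv_anti₀ (pow_pos hρ T) (pow_le_pow_left₀ hρ.le ha T)
  have hsum : M * (ρ ^ T)⁻¹ ≤ 1 / 10 := h.mul_inv_pow_le
  rw [boundaryFactor]
  split_ifs with hratio
  · refine (Finset.sum_le_card_nsmul _ _ (ρ ^ T)⁻¹ fun a _ => hinv a ?_).trans ?_
    · simp only [ρ, growth]
      linarith [a.cast_nonneg (α := ℝ)]
    · rw [Finset.card_range, nsmul_eq_mul]
      linarith
  · have hzero : (growth 0 l ^ T)⁻¹ ≤ 1 := inv_le_one_of_one_le₀ (one_le_pow₀ (one_le_growth 0 l))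
    have hpos (a : ℕ) (ha : 0 < a) : ρ ≤ growth a l := by
      have ha' : (1 : ℝ) ≤ a := by exact_mod_cast ha
      have hM : 1 / ((M : ℝ) + 1) ≤ 1 :=
        div_le_one_of_le₀ (le_add_of_nonneg_left M.cast_nonneg) (by positivity)
      simp only [ρ, growth]
      linarith [denRatio_nonneg l]
    calc _ ≤ ∑ a ∈ Finset.range M, ((ρ ^ T)⁻¹ + if a = 0 then 1 else 0) := by
          refine Finset.sum_le_sum fun a _ => ?_
          split_ifs with ha
          · rw [ha]
            exact hzero.trans (le_add_of_nonneg_left (by positivity))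
          · simpa using hinv a (hpos a (Nat.pos_of_ne_zero ha))
      _ ≤ 1 / 10 + 1 := by
          rw [Finset.sum_add_distrib, Finset.sum_const, Finset.card_range, nsmul_eq_mul,
            Finset.sum_ite_eq']
          refine add_le_add hsum ?_
          split_ifs <;> norm_num
      _ ≤ 4 / 2 - 2 / 5 := by norm_num

theorem tsum_extensionFactor_le (h : IsContracting M T p) (l : List ℕ) :
    ∑' a, ENNReal.ofReal (extensionFactor M T p l a) ≤
      ENNReal.ofReal (boundaryFactor M l / 2) := by
  have hsmall : ∑ a ∈ Finset.range M, ENNReal.ofReal (extensionFactor M T p l a) ≤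
      ENNReal.ofReal (boundaryFactor M l / 2 - 2 / 5) := by
    rw [← ENNReal.ofReal_sum_of_nonneg fun a _ => extensionFactor_nonneg M T p l a]
    refine ENNReal.ofReal_le_ofReal (le_of_eq_of_le ?_ (h.sum_inv_growth_pow_le l))
    exact Finset.sum_congr rfl fun a ha => if_pos (Finset.mem_range.mp ha)
  have hlarge : ∑' a, ENNReal.ofReal (extensionFactor M T p l (a + M)) ≤
      ENNReal.ofReal (2 / 5) := by
    have hterm (a : ℕ) : ENNReal.ofReal (extensionFactor M T p l (a + M)) =
        ENNReal.ofReal 4 * ENNReal.ofReal ((((a + M : ℕ) : ℝ) + 1) ^ (-p)) := by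
      rw [extensionFactor, if_neg (by lia), ENNReal.ofReal_mul (by norm_num)]
    simp only [hterm, ENNReal.tsum_mul_left]
    refine (mul_le_mul_right h.tsum_tail_le _).trans_eq ?_
    rw [← ENNReal.ofReal_mul (by norm_num)]
    norm_num
  rw [← Summable.sum_add_tsum_nat_add' (k := M) ENNReal.summable]
  refine (add_le_add hsmall hlarge).trans_eq ?_
  rw [← ENNReal.ofReal_add (by linarith [one_le_boundaryFactor M l]) (by norm_num), sub_add_cancel]

theorem tsum_wordWeight_cons_le (h : IsContracting M T p) (l : List ℕ) :
    ∑' a, ENNReal.ofReal (wordWeight M T p (a :: l)) ≤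
      ENNReal.ofReal (1 / 2) * ENNReal.ofReal (wordWeight M T p l) := by
  have hcore := coreWeight_nonneg M T p l
  calc _ ≤ ∑' a, ENNReal.ofReal (coreWeight M T p l) *
        ENNReal.ofReal (extensionFactor M T p l a) := by
        refine ENNReal.tsum_le_tsum fun a => ?_
        rw [← ENNReal.ofReal_mul hcore]
        exact ENNReal.ofReal_le_ofReal (wordWeight_cons_le h.nonneg a l)
    _ ≤ ENNReal.ofReal (coreWeight M T p l) * ENNReal.ofReal (boundaryFactor M l / 2) := by
        rw [ENNReal.tsum_mul_left]
        exact mul_le_mul_right (h.tsum_extensionFactor_le l) _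
    _ = _ := by
        rw [← ENNReal.ofReal_mul hcore, ← ENNReal.ofReal_mul (by norm_num), wordWeight]
        congr 1
        ring

theorem tsum_wordWeight_le (h : IsContracting M T p) (n : ℕ) :
    ∑' w : Fin n → ℕ, ENNReal.ofReal (wordWeight M T p (List.ofFn w)) ≤
      ENNReal.ofReal (4 * (1 / 2) ^ n) := by
  induction n with
  | zero =>
    rw [tsum_fintype, Fintype.sum_unique, List.ofFn_zero]
    refine ENNReal.ofReal_le_ofReal ?_
    simpa [wordWeight, coreWeight, wordDen, smallPart] using boundaryFactor_le_four M []
  | succ n ih =>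
    calc _ = ∑' (w : Fin n → ℕ) (a : ℕ),
          ENNReal.ofReal (wordWeight M T p (a :: List.ofFn w)) := by
          rw [← (Fin.consEquiv fun _ => ℕ).tsum_eq, ENNReal.tsum_prod', ENNReal.tsum_comm]
          simp [Fin.consEquiv]
      _ ≤ ENNReal.ofReal (1 / 2) * ENNReal.ofReal (4 * (1 / 2) ^ n) := by
          refine (ENNReal.tsum_le_tsum fun w => h.tsum_wordWeight_cons_le _).trans ?_
          rw [ENNReal.tsum_mul_left]
          exact mul_le_mul_right ih _
      _ = _ := by
          rw [← ENNReal.ofReal_mul (by norm_num)]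
          congr 1
          ring

end IsContracting

end WordWeight

/-- The irrational numbers in `(0, 1)` whose continued fraction expansion begins with a word,
encoded as in `denRatio`. -/
def cylinder (l : List ℕ) : Set ℝ :=
  {α | ∃ a x, IsGaussOrbit a x ∧ x 0 = α ∧ initialWord a l.length = l}

theorem ediam_cylinder_le (l : List ℕ) :
    Metric.ediam (cylinder l) ≤ ENNReal.ofReal (wordDen l ^ (-2 : ℝ)) := by
  refine Metric.ediam_le ?_
  rintro _ ⟨a, x, hx, rfl, ha⟩ _ ⟨b, y, hy, rfl, hb⟩
  rw [edist_dist, Real.dist_eq, hx.abs_sub_eq hy (initialWord_eq_iff.mp (ha.trans hb.symm))]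
  have hx_prod := hx.prod_le_inv_wordDen l.length
  have hy_prod := hy.prod_le_inv_wordDen l.length
  rw [ha] at hx_prod
  rw [hb] at hy_prod
  have hdist : |x l.length - y l.length| ≤ 1 := by
    rw [abs_le]
    constructor <;>
      linarith [hx.pos l.length, hx.lt_one l.length, hy.pos l.length, hy.lt_one l.length]
  have hden := wordDen_pos l
  have hy_prod_pos := hy.prod_pos l.length
  refine ENNReal.ofReal_le_ofReal ?_
  calc _ ≤ (wordDen l)⁻¹ * (wordDen l)⁻¹ * 1 := by gcongr
    _ = _ := by rw [Real.rpow_neg hden.le, Real.rpow_two, mul_one, sq, mul_inv]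

theorem ediam_cylinder_rpow_le {M T : ℕ} {δ p s : ℝ} (hs : 0 ≤ s) (hδ : δ * T ≤ 2 * s - p)
    {l : List ℕ} (hl : smallPart M l ≤ wordDen l ^ δ) :
    Metric.ediam (cylinder l) ^ s ≤ ENNReal.ofReal (wordWeight M T p l) := by
  have hden := wordDen_pos l
  have hsmall := smallPart_pos M l
  refine (ENNReal.rpow_le_rpow (ediam_cylinder_le l) hs).trans ?_
  rw [ENNReal.ofReal_rpow_of_nonneg (by positivity) hs, ← Real.rpow_mul hden.le]
  refine ENNReal.ofReal_le_ofReal ?_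
  calc wordDen l ^ (-2 * s) ≤ wordDen l ^ (-p + -(δ * T)) :=
        Real.rpow_le_rpow_of_exponent_le (one_le_wordDen l) (by linarith)
    _ = wordDen l ^ (-p) * ((wordDen l ^ δ) ^ T)⁻¹ := by
        rw [Real.rpow_add hden, Real.rpow_neg hden.le (δ * T), Real.rpow_mul_natCast hden.le]
    _ ≤ coreWeight M T p l := by
        rw [coreWeight]
        gcongr
    _ ≤ wordWeight M T p l :=
        le_mul_of_one_le_left (coreWeight_nonneg M T p l) (one_le_boundaryFactor M l)

namespace IsGaussOrbit

variable {a : ℕ → ℕ} {x : ℕ → ℝ}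

theorem log_smallPart_succ_le (h : IsGaussOrbit a x) {M n : ℕ}
    (hn : (M + 1 : ℝ) < 2 * Real.log (wordDen (initialWord a n))) :
    Real.log (smallPart M (initialWord a (n + 1))) ≤
      Real.log (smallPart M (initialWord a n)) +
        W (x 0) n * Real.log (wordDen (initialWord a n)) := by
  have hlog : 0 < Real.log (wordDen (initialWord a n)) := by linarith [M.cast_nonneg (α := ℝ)]
  have hden := wordDen_pos (initialWord a n)
  rw [initialWord_succ, smallPart]
  split_ifs with ha
  · have hgrowth := zero_lt_one.trans_le (one_le_growth (a n) (initialWord a n))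
    have hsucc : cfDen (x 0) (n + 1) =
        wordDen (initialWord a n) * growth (a n) (initialWord a n) := by
      rw [h.cfDen_eq, initialWord_succ, wordDen]
    have hcase : cfDen (x 0) (n + 1) < 2 * cfDen (x 0) n * Real.log (cfDen (x 0) n) := by
      rw [hsucc, h.cfDen_eq, mul_right_comm, mul_comm]
      exact mul_lt_mul_of_pos_right ((growth_le_of_lt ha _).trans_lt hn) hden
    have hW := W_mul_log_cfDen hcase (by rw [h.cfDen_eq]; exact hlog.ne')
    rw [hsucc, Real.log_mul hden.ne' hgrowth.ne', h.cfDen_eq, add_sub_cancel_left] at hW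
    rw [hW, Real.log_mul hgrowth.ne' (smallPart_pos M _).ne', add_comm]
  · rw [one_mul]
    exact le_add_of_nonneg_right (mul_nonneg (W_nonneg _ _) hlog.le)

theorem eventually_smallPart_le (h : IsGaussOrbit a x) (hW : Summable (W (x 0))) (M : ℕ) {δ : ℝ}
    (hδ : 0 < δ) :
    ∀ᶠ n in atTop, smallPart M (initialWord a n) ≤ wordDen (initialWord a n) ^ δ := by
  have htop : Tendsto (fun n => Real.log (wordDen (initialWord a n))) atTop atTop :=
    Real.tendsto_log_atTop.comp (tendsto_wordDen_initialWord a)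
  have hmono : Monotone fun n => Real.log (wordDen (initialWord a n)) := fun m n hmn =>
    Real.log_le_log (wordDen_pos _) (wordDen_initialWord_mono a hmn)
  have hstep : ∀ᶠ n in atTop, Real.log (smallPart M (initialWord a (n + 1))) ≤
      Real.log (smallPart M (initialWord a n)) +
        W (x 0) n * Real.log (wordDen (initialWord a n)) := by
    filter_upwards [htop.eventually_gt_atTop (((M : ℝ) + 1) / 2)] with n hn
    exact h.log_smallPart_succ_le ((div_lt_iff₀' two_pos).mp hn)
  filter_upwards [eventually_le_mul_of_le_add_mul
    (s := fun n => Real.log (smallPart M (initialWord a n))) htop hmono (W_nonneg _) hW hstep hδ]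
    with n hn
  rw [← Real.log_le_log_iff (smallPart_pos M _) (Real.rpow_pos_of_pos (wordDen_pos _) _),
    Real.log_rpow (wordDen_pos _)]
  exact hn

end IsGaussOrbit

theorem hausdorffMeasure_finiteWSet_eq_zero {s : ℝ} (hs : 1 / 2 < s) : μH[s] finiteWSet = 0 := by
  obtain ⟨M, T, hMT⟩ := exists_isContracting (p := s + 1 / 2) (by linarith)
  let δ := (s - 1 / 2) / (T + 1)
  have hδ : 0 < δ := div_pos (by linarith) (by positivity)
  have hδT : δ * T ≤ 2 * s - (s + 1 / 2) := by
    have hδ_mul : δ * (T + 1) = s - 1 / 2 := div_mul_cancel₀ _ (by positivity)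
    linarith
  have hs_pos : 0 < s := by linarith
  refine hausdorffMeasure_eq_zero_of_tendsto_tsum_ediam_rpow
    (ι := fun n => {w : Fin n → ℕ // smallPart M (List.ofFn w) ≤ wordDen (List.ofFn w) ^ δ})
    (t := fun n w => cylinder (List.ofFn w.1)) hs_pos ?_ ?_
  · rintro α ⟨hα, hirr, hW⟩
    obtain ⟨a, x, hx, rfl⟩ := exists_isGaussOrbit_of_irrational hα hirr
    filter_upwards [hx.eventually_smallPart_le ((summable_nat_add_iff 1).mp hW) M hδ] with n hn
    exact ⟨⟨fun i => a i.rev, hn⟩, a, x, hx, rfl, by rw [List.length_ofFn]; rfl⟩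
  · have hgeom : Tendsto (fun n : ℕ => ENNReal.ofReal (4 * (1 / 2) ^ n)) atTop (𝓝 0) := by
      have hreal := (tendsto_pow_atTop_nhds_zero_of_lt_one (r := (1 / 2 : ℝ)) (by norm_num)
        (by norm_num)).const_mul 4
      simpa using ENNReal.tendsto_ofReal hreal
    refine tendsto_of_tendsto_of_tendsto_of_le_of_le tendsto_const_nhds hgeom
      (fun _ => zero_le) fun n => ?_
    calc _ ≤ ∑' w : {w : Fin n → ℕ // smallPart M (List.ofFn w) ≤ wordDen (List.ofFn w) ^ δ},
          ENNReal.ofReal (wordWeight M T (s + 1 / 2) (List.ofFn w.1)) :=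
          ENNReal.tsum_le_tsum fun w => ediam_cylinder_rpow_le hs_pos.le hδT w.2
      _ ≤ ∑' w : Fin n → ℕ, ENNReal.ofReal (wordWeight M T (s + 1 / 2) (List.ofFn w)) :=
          ENNReal.tsum_comp_le_tsum_of_injective Subtype.val_injective _
      _ ≤ ENNReal.ofReal (4 * (1 / 2) ^ n) := hMT.tsum_wordWeight_le n

theorem volume_finiteWSet : volume finiteWSet = 0 := by
  rw [← hausdorffMeasure_real]
  exact hausdorffMeasure_finiteWSet_eq_zero one_half_lt_one

theorem dimH_finiteWSet_le : dimH finiteWSet ≤ 1 / 2 := by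
  refine le_of_forall_gt_imp_ge_of_dense fun s hs => ?_
  induction s with
  | top => exact le_top
  | coe s =>
    have hs' : (1 / 2 : ℝ) < s := by
      have hcoe : ((1 / 2 : ℝ≥0) : ℝ≥0∞) < s := by simpa using hs
      exact_mod_cast hcoe
    refine dimH_le_of_hausdorffMeasure_ne_top ?_
    rw [hausdorffMeasure_finiteWSet_eq_zero hs']
    exact ENNReal.zero_ne_top

/-! ### The lower bound -/

/-- The sequence `2 ^ (k + 1) + d k`, where `d` are the mixed radix digits of `y` in the bases
`2, 4, 8, …`. It serves as the letters of a continued fraction, and determines `y ∈ [0, 1)`. -/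
noncomputable def dyadicLetter (y : ℝ) (k : ℕ) : ℕ :=
  2 ^ (k + 1) + mixedRadixDigit (fun j => 2 ^ (j + 1)) y k

theorem two_pow_le_dyadicLetter (y : ℝ) (k : ℕ) : 2 ^ (k + 1) ≤ dyadicLetter y k :=
  Nat.le_add_right _ _

theorem dyadicLetter_lt (y : ℝ) (k : ℕ) : dyadicLetter y k < 2 ^ (k + 2) := by
  rw [dyadicLetter, pow_succ 2 (k + 1), mul_two]
  exact Nat.add_lt_add_left
    (mixedRadixDigit_lt (b := fun j => 2 ^ (j + 1)) (fun j => pow_ne_zero _ two_ne_zero) y k) _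

theorem injOn_dyadicLetter : Set.InjOn dyadicLetter (Set.Ico 0 1) := fun _ hy _ hz h =>
  injOn_mixedRadixDigit (fun j => Nat.le_self_pow j.succ_ne_zero 2) hy hz <|
    funext fun k => Nat.add_left_cancel (congrFun h k)

theorem abs_sub_le_of_dyadicLetter_eq {y z : ℝ} (hy : y ∈ Set.Ico (0 : ℝ) 1)
    (hz : z ∈ Set.Ico (0 : ℝ) 1) {n : ℕ} (h : ∀ k < n, dyadicLetter y k = dyadicLetter z k) :
    |y - z| ≤ 2 ^ (-((n : ℝ) * (n + 1) / 2)) := by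
  have hdist := abs_sub_le_of_mixedRadixDigit_eq (b := fun j => 2 ^ (j + 1))
    (fun j => pow_ne_zero _ two_ne_zero) hy hz fun k hk => Nat.add_left_cancel (h k hk)
  push_cast at hdist
  rw [prod_range_pow_add two_pos, ← Real.rpow_neg two_pos.le] at hdist
  convert hdist using 3
  push_cast
  ring

theorem two_rpow_le_wordDen {a : ℕ → ℕ} (ha : ∀ k, 2 ^ (k + 1) ≤ a k) (n : ℕ) :
    (2 : ℝ) ^ ((n : ℝ) * (n + 1) / 2) ≤ wordDen (initialWord a n) := by
  have hexp : (n : ℝ) * (n + 1) / 2 = (n : ℝ) * (n - 1) / 2 + (1 : ℕ) * n := by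
    push_cast
    ring
  rw [hexp, ← prod_range_pow_add two_pos]
  refine le_trans (Finset.prod_le_prod (fun k _ => by positivity) fun k _ => ?_)
    (prod_le_wordDen a n)
  have hak : (2 : ℝ) ^ (k + 1) ≤ a k := by exact_mod_cast ha k
  linarith

namespace IsGaussOrbit

variable {a b : ℕ → ℕ} {x y : ℕ → ℝ}

theorem summable_W (h : IsGaussOrbit a x) (ha : ∀ k, 2 ^ (k + 1) ≤ a k) : Summable (W (x 0)) := by
  refine summable_W_of_mul_rpow_le_log (c := 1 / 4) (r := 2) (by norm_num) one_lt_two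
    (.of_forall fun n => ?_)
  have hlog := Real.log_le_log (by positivity) (two_rpow_le_wordDen ha n)
  rw [Real.log_rpow two_pos] at hlog
  rw [h.cfDen_eq, Real.rpow_two]
  nlinarith [Real.log_two_gt_d9, n.cast_nonneg (α := ℝ)]

theorem two_rpow_le_prod (h : IsGaussOrbit a x) (ha : ∀ k, a k < 2 ^ (k + 2)) (n : ℕ) :
    (2 : ℝ) ^ (-((n : ℝ) * (n + 5) / 2)) ≤ ∏ k ∈ Finset.range n, x k := by
  have hB (k : ℕ) : a k + 2 ≤ 2 ^ (k + 3) := by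
    have hpow : 2 ≤ 2 ^ (k + 2) := Nat.le_self_pow (by lia) 2
    rw [pow_succ 2 (k + 2)]
    linarith [ha k]
  refine le_of_eq_of_le ?_ (h.inv_prod_le_prod hB n)
  push_cast
  rw [prod_range_pow_add two_pos, ← Real.rpow_neg two_pos.le]
  push_cast
  ring_nf

theorem le_half_of_one_le (h : IsGaussOrbit a x) {n : ℕ} (ha : 1 ≤ a n) : x n ≤ 1 / 2 := by
  have han : (1 : ℝ) ≤ a n := by exact_mod_cast ha
  rw [one_div]
  refine le_inv_of_le_inv₀ two_pos ?_
  rw [h.inv_eq]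
  linarith [h.pos (n + 1)]

theorem two_rpow_le_abs_sub (hx : IsGaussOrbit a x) (hy : IsGaussOrbit b y)
    (ha : ∀ k, 2 ^ (k + 1) ≤ a k) (ha' : ∀ k, a k < 2 ^ (k + 2))
    (hb : ∀ k, 2 ^ (k + 1) ≤ b k) (hb' : ∀ k, b k < 2 ^ (k + 2)) {n : ℕ}
    (hab : ∀ k < n, a k = b k) (hne : a n ≠ b n) :
    (2 : ℝ) ^ (-((n : ℝ) ^ 2 + 7 * n + 7)) ≤ |x 0 - y 0| := by
  refine le_trans ?_ (hx.le_abs_sub_of_ne hy hab hne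
    (hx.le_half_of_one_le (Nat.one_le_two_pow.trans (ha _)))
    (hy.le_half_of_one_le (Nat.one_le_two_pow.trans (hb _))))
  have hprod := mul_le_mul (hx.two_rpow_le_prod ha' (n + 1)) (hy.two_rpow_le_prod hb' (n + 1))
    (by positivity) (hx.prod_pos _).le
  rw [← Real.rpow_add two_pos] at hprod
  refine le_of_eq_of_le ?_ (div_le_div_of_nonneg_right hprod two_pos.le)
  rw [← Real.rpow_sub_one two_ne_zero]
  push_cast
  ring_nf

end IsGaussOrbit

theorem quadratic_mul_le {s : ℝ} (hs : s < 1 / 2) {n : ℝ} (hn : 0 ≤ n) :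
    (n ^ 2 + 7 * n + 7) * s ≤ n * (n + 1) / 2 + (4 + 9 / (2 * (1 - 2 * s))) := by
  have hgap : 0 < 1 - 2 * s := by linarith
  have hsq : 0 ≤ (1 - 2 * s) * n ^ 2 / 2 - 3 * n + 9 / (2 * (1 - 2 * s)) := by
    have hsq_nonneg : 0 ≤ ((1 - 2 * s) * n - 3) ^ 2 / (2 * (1 - 2 * s)) := by positivity
    convert hsq_nonneg using 1
    field_simp
    ring
  linarith [mul_nonneg hgap.le hn]

theorem abs_sub_le_mul_rpow {s : ℝ} (hs₀ : 0 ≤ s) (hs : s < 1 / 2) {y z : ℝ}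
    (hy : y ∈ Set.Ico (0 : ℝ) 1) (hz : z ∈ Set.Ico (0 : ℝ) 1) {v w : ℕ → ℝ}
    (hv : IsGaussOrbit (dyadicLetter y) v) (hw : IsGaussOrbit (dyadicLetter z) w) :
    |y - z| ≤ 2 ^ (4 + 9 / (2 * (1 - 2 * s))) * |v 0 - w 0| ^ s := by
  rcases eq_or_ne y z with rfl | hyz
  · rw [sub_self, abs_zero]
    positivity
  let n := PiNat.firstDiff (dyadicLetter y) (dyadicLetter z)
  have hne : dyadicLetter y n ≠ dyadicLetter z n :=
    PiNat.apply_firstDiff_ne (injOn_dyadicLetter.ne hy hz hyz)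
  have hagree (k : ℕ) (hk : k < n) : dyadicLetter y k = dyadicLetter z k :=
    PiNat.apply_eq_of_lt_firstDiff hk
  have hsep := hv.two_rpow_le_abs_sub hw (two_pow_le_dyadicLetter y) (dyadicLetter_lt y)
    (two_pow_le_dyadicLetter z) (dyadicLetter_lt z) hagree hne
  calc |y - z| ≤ 2 ^ (-((n : ℝ) * (n + 1) / 2)) := abs_sub_le_of_dyadicLetter_eq hy hz hagree
    _ ≤ 2 ^ (4 + 9 / (2 * (1 - 2 * s)) + -((n : ℝ) ^ 2 + 7 * n + 7) * s) :=
        Real.rpow_le_rpow_of_exponent_le one_le_two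
          (by linarith [quadratic_mul_le hs n.cast_nonneg])
    _ = 2 ^ (4 + 9 / (2 * (1 - 2 * s))) * ((2 : ℝ) ^ (-((n : ℝ) ^ 2 + 7 * n + 7))) ^ s := by
        rw [Real.rpow_add two_pos, Real.rpow_mul two_pos.le]
    _ ≤ 2 ^ (4 + 9 / (2 * (1 - 2 * s))) * |v 0 - w 0| ^ s := by gcongr

theorem le_dimH_finiteWSet_of_lt_half {s : ℝ≥0} (hs₀ : 0 < s) (hs : (s : ℝ) < 1 / 2) :
    (s : ℝ≥0∞) ≤ dimH finiteWSet := by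
  choose x hx using fun y => exists_isGaussOrbit (dyadicLetter y)
  let C : ℝ≥0 := 2 ^ (4 + 9 / (2 * (1 - 2 * (s : ℝ))))
  have hholder : ∀ y ∈ Set.Ico (0 : ℝ) 1, ∀ z ∈ Set.Ico (0 : ℝ) 1,
      edist y z ≤ C * edist (x y 0) (x z 0) ^ (s : ℝ) := by
    intro y hy z hz
    rw [edist_dist, edist_dist, Real.dist_eq, Real.dist_eq,
      ENNReal.ofReal_rpow_of_nonneg (abs_nonneg _) s.coe_nonneg, ← ENNReal.ofReal_coe_nnreal,
      ← ENNReal.ofReal_mul C.coe_nonneg]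
    refine ENNReal.ofReal_le_ofReal ?_
    simpa [C] using abs_sub_le_mul_rpow hs₀.le hs hy hz (hx y) (hx z)
  have himage : (fun y => x y 0) '' Set.Ico (0 : ℝ) 1 ⊆ finiteWSet := by
    rintro _ ⟨y, -, rfl⟩
    exact ⟨⟨(hx y).pos 0, (hx y).lt_one 0⟩, (hx y).irrational,
      (summable_nat_add_iff 1).mpr ((hx y).summable_W (two_pow_le_dyadicLetter y))⟩
  have hinterval : dimH (Set.Ico (0 : ℝ) 1) = 1 := by
    rw [Real.dimH_of_nonempty_interior (by simp), Module.finrank_self, Nat.cast_one]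
  have hone : 1 ≤ dimH finiteWSet / s := hinterval ▸
    (dimH_le_dimH_image_div_of_edist_le hs₀ hholder).trans
      (ENNReal.div_le_div_right (dimH_mono himage) _)
  rwa [ENNReal.le_div_iff_mul_le (by simp [hs₀.ne']) (by simp), one_mul] at hone

theorem half_le_dimH_finiteWSet : 1 / 2 ≤ dimH finiteWSet := by
  refine le_of_forall_lt_imp_le_of_dense fun s hs => ?_
  lift s to ℝ≥0 using hs.ne_top
  rcases eq_zero_or_pos s with rfl | hs₀
  · simp
  have hs' : (s : ℝ) < 1 / 2 := by
    have hcoe : (s : ℝ≥0∞) < ((1 / 2 : ℝ≥0) : ℝ≥0∞) := by simpa using hs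
    exact_mod_cast hcoe
  exact le_dimH_finiteWSet_of_lt_half hs₀ hs'

theorem mainTheorem2 :
    MeasureTheory.volume finiteWSet = 0 ∧ dimH finiteWSet = 1 / 2 :=
  ⟨volume_finiteWSet, le_antisymm dimH_finiteWSet_le half_le_dimH_finiteWSet⟩
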